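/- **Setting.** There are $n$ agents; agent $i$ has a type in a set $\Theta_i$ (a measurable space). A mechanism maps the $n$ reported types to an outcome, and $u_{i,M}(\theta,\hat\theta)\in[-1,1]$ is the utility of agent $i$ under the mechanism $M$ when the types are $\theta$ and the reported types are $\hat\theta$; write $u_{i,M}(\theta_i,\hat\theta_i,\theta_{-i}):=u_{i,M}((\theta_i,\theta_{-i}),(\hat\theta_i,\theta_{-i}))$. Let $\mathcal M$ be a class of mechanisms and $$\mathcal F_{i,\mathcal M}=\{\theta_{-i}\mapsto u_{i,M}(\theta_i,\hat\theta_i,\theta_{-i}) : \theta_i,\hat\theta_i\in\Theta_i,\ M\in\mathcal M\}.$$ Let $d_i=\mathrm{Pdim}(\mathcal F_{i,\mathcal M})$, assumed finite, be its pseudo-dimension, i.e. the largest size of a finite set $S$ of profiles $\theta_{-i}$ for which there are $z:S\to\mathbb R$ such that for every $T\subseteq S$ some $f\in\mathcal F_{i,\mathcal M}$ satisfies $f(s)\ge z(s)\iff s\in T$ for all $s\in S$. The agents' types are independent, and $\mathcal D_{-i}$ denotes the (product) distribution of $\theta_{-i}$. **Algorithm.** Given $M\in\mathcal M$, a sample $\mathcal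 S_{-i}=(\theta_{-i}^{(1)},\dots,\theta_{-i}^{(N)})$ with $N\ge1$, and $\epsilon>0$, put $$v(\theta_i,\hat\theta_i)=\tfrac1N\Big(u_{i,M}(\theta_i,\hat\theta_i,\theta_{-i}^{(j)})-u_{i,M}(\theta_i,\theta_i,\theta_{-i}^{(j)})\Big)_{j=1}^N\in\mathbb R^N,\qquad U=\{v(\theta_i,\hat\theta_i):\theta_i,\hat\theta_i\in\Theta_i\}.$$ Start with $V=\mathcal G=\emptyset$. While $U\setminus\bigcup_{v\in V}B_1(v,\epsilon)\neq\emptyset$, select an arbitrary vector $v'$ of this set and an arbitrary pair $(\theta_i,\hat\theta_i)$ with $v'=v(\theta_i,\hat\theta_i)$, add $v'$ to $V$ and the pair to $\mathcal G$. Return $\mathcal G$. Here $B_1$ is the $\ell_1$-ball (the result holds for open balls and for closed balls). Any set $\mathcal G$ that this procedure may return is denoted $\mathcal G(\mathcal S_{-i},M,\epsilon)$. **Theorem.** There is a universal constant $C>0$ such that the following holds for all $n$, $N\ge1$, $\epsilon>0$ and all type spaces, utilities and mechanism classes as above. 1. Let $0<\delta<1$. Suppose that all functions in $\mathcal F_{i,\mathcal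 M}$ are measurable and that the class is measurable in the usual sense of empirical process theory: for all $m$ and all signs $\sigma\in\{-1,1\}^m$, the map $(x_1,\dots,x_m)\mapsto\sup_{f\in\mathcal F_{i,\mathcal M}}|\sum_{j}\sigma_jf(x_j)|$ is measurable for the completion of $\mathcal D_{-i}^m$ (this is automatic for a countable class). Then with probability at least $1-\delta$ over the draw of the $n$ samples $\mathcal S_{-i}\sim\mathcal D_{-i}^N$ (however they are coupled), for every $M\in\mathcal M$, every agent $i$, every possible output $\mathcal G(\mathcal S_{-i},M,\epsilon)$ and all $\theta_i,\hat\theta_i\in\Theta_i$, $$\mathbb E_{\theta_{-i}\sim\mathcal D_{-i}}\big[u_{i,M}(\theta_i,\hat\theta_i,\theta_{-i})-u_{i,M}(\theta_i,\theta_i,\theta_{-i})\big]\le\max_{(\theta'_i,\hat\theta'_i)\in\mathcal G(\mathcal S_{-i},M,\epsilon)}\frac1N\sum_{j=1}^N\Big(u_{i,M}(\theta'_i,\hat\theta'_i,\theta_{-i}^{(j)})-u_{i,M}(\theta'_i,\theta'_i,\theta_{-i}^{(j)})\Big)+\epsilon+C\,r_i,$$ where $$r_i=\sqrt{\frac{d_i}{N}\ln\!\Big(e\max\{1,\tfrac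 N{d_i}\}\Big)}+\sqrt{\frac{1}{N}\ln\frac{2n}{\delta}}=\tilde O\!\left(\sqrt{d_i/N}\right)$$ (the first summand is $0$ if $d_i=0$). "With probability at least $1-\delta$" means that the exceptional set has outer probability at most $\delta$. 2. For every $M\in\mathcal M$, every $i$ and every sample $\mathcal S_{-i}$ of size $N$, every run of the algorithm terminates; and if $\epsilon d_i\le 8N$, every possible output satisfies $$|\mathcal G(\mathcal S_{-i},M,\epsilon)|\le\left(\frac{8eN}{\epsilon d_i}\right)^{2d_i}$$ (the right side is read as $1$ if $d_i=0$). -/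

import Mathlib

open MeasureTheory

namespace AIC

/-! ### Agents, mechanisms and utilities -/

/-- Type profiles of all agents. -/
abbrev Profile {n : ℕ} (Θ : Fin n → Type*) := ∀ j, Θ j

/-- Type profiles `θ₋ᵢ` of all agents except agent `i`. -/
abbrev Others {n : ℕ} (Θ : Fin n → Type*) (i : Fin n) := ∀ j : {j : Fin n // j ≠ i}, Θ j

/-- A mechanism maps the reported types of all agents to an outcome. -/
abbrev Mechanism {n : ℕ} (Θ : Fin n → Type*) (O : Type*) := Profile Θ → O

/-- The type profile `(θᵢ, θ₋ᵢ)`. -/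
def combine {n : ℕ} {Θ : Fin n → Type*} (i : Fin n) (t : Θ i) (x : Others Θ i) : Profile Θ :=
  (Equiv.piSplitAt i Θ).symm (t, x)

/-- `u_{i,M}(θ, θ')`: the utility of agent `i` under the mechanism `M`, when the agents' types are
`θ` and their reported types are `θ'`. Here `util i θ o` is the utility that agent `i` derives from
the outcome `o` if the agents' types are `θ`. -/
def utility {n : ℕ} {Θ : Fin n → Type*} {O : Type*} (util : Fin n → Profile Θ → O → ℝ)
    (i : Fin n) (M : Mechanism Θ O) (θ θ' : Profile Θ) : ℝ :=
  util i θ (M θ')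

/-- `u_{i,M}(θᵢ, θ'ᵢ, θ₋ᵢ)`: agent `i` has type `t` and reports `t'`, the other agents have types `x`
and report truthfully. -/
def utilityTruthfulOthers {n : ℕ} {Θ : Fin n → Type*} {O : Type*}
    (util : Fin n → Profile Θ → O → ℝ) (i : Fin n) (M : Mechanism Θ O) (t t' : Θ i)
    (x : Others Θ i) : ℝ :=
  utility util i M (combine i t x) (combine i t' x)

/-- The class of all functions `θ₋ᵢ ↦ u_{i,M}(θᵢ, θ'ᵢ, θ₋ᵢ)` with `θᵢ, θ'ᵢ ∈ Θᵢ` and `M` in the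
mechanism class. -/
def utilityClass {n : ℕ} {Θ : Fin n → Type*} {O : Type*} (util : Fin n → Profile Θ → O → ℝ)
    (Ms : Set (Mechanism Θ O)) (i : Fin n) : Set (Others Θ i → ℝ) :=
  {f | ∃ M ∈ Ms, ∃ t t' : Θ i, f = utilityTruthfulOthers util i M t t'}

/-- The law of `θ₋ᵢ` when the agents' types are independent, agent `j`'s type having law `D j`. -/
noncomputable def othersLaw {n : ℕ} {Θ : Fin n → Type*} [∀ j, MeasurableSpace (Θ j)]
    (D : ∀ j, Measure (Θ j)) (i : Fin n) : Measure (Others Θ i) :=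
  Measure.pi fun j : {j : Fin n // j ≠ i} => D j

/-! ### Pseudo-dimension -/

/-- The finite set `S` is shattered by `F`, with some real targets `z` as witnesses. -/
def Shatters {X : Type*} (F : Set (X → ℝ)) (S : Finset X) : Prop :=
  ∃ z : X → ℝ, ∀ T ⊆ S, ∃ f ∈ F, ∀ x ∈ S, z x ≤ f x ↔ x ∈ T

/-- The pseudo-dimension of `F`: the largest size of a shattered set (possibly infinite). -/
noncomputable def pdim {X : Type*} (F : Set (X → ℝ)) : ℕ∞ :=
  ⨆ S : {S : Finset X // Shatters F S}, (S.1.card : ℕ∞)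

/-- Measurability of a class of functions in the sense of empirical process theory: for all `m` and
all signs, the supremum over the class of the signed sums over an i.i.d. sample of size `m` is
measurable with respect to the completion of the law of the sample. -/
def IsMeasurableClass {X : Type*} [MeasurableSpace X] (μ : Measure X) (F : Set (X → ℝ)) : Prop :=
  ∀ (m : ℕ) (σ : Fin m → ℝ), (∀ j, σ j = 1 ∨ σ j = -1) →
    AEMeasurable (fun x : Fin m → X => ⨆ f : F, |∑ j, σ j * f.1 (x j)|)
      (Measure.pi fun _ : Fin m => μ)

/-! ### Utility gains -/

/-- The true ex-interim utility gain of agent `i` with type `t` from reporting `t'`. -/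
noncomputable def trueGain {n : ℕ} {Θ : Fin n → Type*} {O : Type*}
    [∀ j, MeasurableSpace (Θ j)] (util : Fin n → Profile Θ → O → ℝ) (D : ∀ j, Measure (Θ j))
    (i : Fin n) (M : Mechanism Θ O) (t t' : Θ i) : ℝ :=
  ∫ x, (utilityTruthfulOthers util i M t t' x - utilityTruthfulOthers util i M t t x)
    ∂(othersLaw D i)

/-- The utility gain for the type pair `p = (θᵢ, θ'ᵢ)` on average over the sample `x`. -/
noncomputable def empiricalGain {n N : ℕ} {Θ : Fin n → Type*} {O : Type*}
    (util : Fin n → Profile Θ → O → ℝ) (i : Fin n) (M : Mechanism Θ O)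
    (x : Fin N → Others Θ i) (p : Θ i × Θ i) : ℝ :=
  (1 / (N : ℝ)) * ∑ j, (utilityTruthfulOthers util i M p.1 p.2 (x j)
    - utilityTruthfulOthers util i M p.1 p.1 (x j))

/-- The vector in `ℝ^N` of the utility gains over the sample for the type pair `p = (θᵢ, θ'ᵢ)`,
scaled by `1 / N`. -/
noncomputable def gainVector {n N : ℕ} {Θ : Fin n → Type*} {O : Type*}
    (util : Fin n → Profile Θ → O → ℝ) (i : Fin n) (M : Mechanism Θ O)
    (x : Fin N → Others Θ i) (p : Θ i × Θ i) : Fin N → ℝ :=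
  fun j => (1 / (N : ℝ)) * (utilityTruthfulOthers util i M p.1 p.2 (x j)
    - utilityTruthfulOthers util i M p.1 p.1 (x j))

/-! ### The greedy cover algorithm -/

/-- The open `ℓ₁` ball in `ℝ^N`. -/
def openBall {N : ℕ} (v : Fin N → ℝ) (r : ℝ) : Set (Fin N → ℝ) := {w | ∑ j, |w j - v j| < r}

/-- The closed `ℓ₁` ball in `ℝ^N`. -/
def closedBall {N : ℕ} (v : Fin N → ℝ) (r : ℝ) : Set (Fin N → ℝ) := {w | ∑ j, |w j - v j| ≤ r}

/-- The vectors of `U = {vec p}` that are not yet covered: `U \ ⋃_{v ∈ V} B(v, ε)`. -/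
def uncovered {N : ℕ} {P : Type*} (B : (Fin N → ℝ) → ℝ → Set (Fin N → ℝ))
    (vec : P → Fin N → ℝ) (ε : ℝ) (V : Finset (Fin N → ℝ)) : Set (Fin N → ℝ) :=
  Set.range vec \ ⋃ v ∈ V, B v ε

open Classical in
/-- One iteration of the while loop on the state `(V, G)`: an arbitrary uncovered vector
`v' = vec p` is added to `V`, and `p` is added to `G`. -/
def GreedyStep {N : ℕ} {P : Type*} (B : (Fin N → ℝ) → ℝ → Set (Fin N → ℝ))
    (vec : P → Fin N → ℝ) (ε : ℝ)
    (s s' : Finset (Fin N → ℝ) × Finset P) : Prop :=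
  ∃ v' ∈ uncovered B vec ε s.1, ∃ p : P, v' = vec p ∧ s' = (insert v' s.1, insert p s.2)

/-- `G` is a possible output of the algorithm: some run starting at `V = ∅`, `G = ∅` ends with the
set `G` in a state in which the loop condition fails. -/
def GreedyReturns {N : ℕ} {P : Type*} (B : (Fin N → ℝ) → ℝ → Set (Fin N → ℝ))
    (vec : P → Fin N → ℝ) (ε : ℝ) (G : Finset P) : Prop :=
  ∃ V : Finset (Fin N → ℝ),
    Relation.ReflTransGen (GreedyStep B vec ε) (∅, ∅) (V, G) ∧ uncovered B vec ε V = ∅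

/-- The algorithm has no infinite run, so every run ends and returns a set. -/
def GreedyTerminates {N : ℕ} {P : Type*} (B : (Fin N → ℝ) → ℝ → Set (Fin N → ℝ))
    (vec : P → Fin N → ℝ) (ε : ℝ) : Prop :=
  ¬ ∃ s : ℕ → Finset (Fin N → ℝ) × Finset P,
    s 0 = (∅, ∅) ∧ ∀ k, GreedyStep B vec ε (s k) (s (k + 1))

/-- The error rate `√(d/N)` up to logarithmic factors, written out:
`√((d/N) ln(e max(1, N/d))) + √(ln(2n/δ)/N)`. -/
noncomputable def errorRate (n N d : ℕ) (δ : ℝ) : ℝ :=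
  Real.sqrt ((d : ℝ) / N * Real.log (Real.exp 1 * max 1 ((N : ℝ) / d)))
    + Real.sqrt (Real.log (2 * n / δ) / N)

end AIC

/-! Both halves rest on one count. Cutting the functions at thresholds turns the class into a finite
family of sets of indices; indices shattered by this family give a shattered set of points, so
Sauer–Shelah bounds the number of patterns on `m` thresholds by a polynomial in `m` of degree `d`
(`card_patterns_le`).

Size of the cover: the selected gain vectors are `ε`-separated in `ℓ₁`. A gain is a difference of
two utilities; if both have the same patterns on a grid of width `ε / 2` at every sample point, the
gain vectors are closer than `ε`. So the selected pairs inject into pairs of patterns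
(`card_le_of_separated`), which gives termination and the exponent `2d`.

Guarantee: the output covers all gain vectors up to `ε` in `ℓ₁`, and the sum of coordinates is
1-Lipschitz, so only the uniform deviation of sample averages from means remains
(`measure_deviation_le`). It is controlled by exponential moments. A ghost sample replaces the mean
by Jensen, and exchanging the two samples introduces random signs (`lintegral_exp_signedSup_le`). Up
to a small error a function is an average of `K` threshold indicators, and Jensen takes this average
out of the exponential (`exists_exp_signed_sum_bound`). Patterns are therefore counted at one level
at a time, on `2N` indices, and the count does not grow with `K`. Markov's inequality and a union
bound over the agents finish the proof. -/

namespace AIC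

/-! ### Threshold patterns of a class of finite pseudo-dimension -/

open Classical in
/-- The set of indices `i` at which `f` reaches the threshold `t i` in the point `x i`. -/
noncomputable def pattern {X ι : Type*} [Fintype ι] (x : ι → X) (t : ι → ℝ) (f : X → ℝ) :
    Finset ι :=
  Finset.univ.filter fun i => t i ≤ f (x i)

open Classical in
/-- All threshold patterns that the functions of a class produce. -/
noncomputable def patterns {X ι : Type*} [Fintype ι] (F : Set (X → ℝ)) (x : ι → X) (t : ι → ℝ) :
    Finset (Finset ι) :=
  Finset.univ.filter fun A => ∃ f ∈ F, A = pattern x t f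

lemma mem_pattern {X ι : Type*} [Fintype ι] {x : ι → X} {t : ι → ℝ} {f : X → ℝ} {i : ι} :
    i ∈ pattern x t f ↔ t i ≤ f (x i) := by
  simp [pattern]

lemma pattern_mem_patterns {X ι : Type*} [Fintype ι] {F : Set (X → ℝ)} (x : ι → X) (t : ι → ℝ)
    {f : X → ℝ} (hf : f ∈ F) : pattern x t f ∈ patterns F x t := by
  simp only [patterns, Finset.mem_filter, Finset.mem_univ, true_and]
  exact ⟨f, hf, rfl⟩

-- Of two indices over the same point, the one with the smaller threshold lies in every pattern that
-- contains the other, so the singleton of the larger one cannot be cut out.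
open Classical in
lemma injOn_of_shatters_patterns {X ι : Type*} [Fintype ι] {F : Set (X → ℝ)} {x : ι → X}
    {t : ι → ℝ} {A : Finset ι} (hA : (patterns F x t).Shatters A) : Set.InjOn x A := by
  have key : ∀ i ∈ A, ∀ j ∈ A, x i = x j → t i ≤ t j → i = j := by
    intro i hi j hj hx ht
    by_contra hij
    obtain ⟨u, hu, hut⟩ := hA (Finset.singleton_subset_iff.2 hj)
    simp only [patterns, Finset.mem_filter, Finset.mem_univ, true_and] at hu
    obtain ⟨f, -, rfl⟩ := hu
    have h1 : j ∈ A ∩ pattern x t f := by rw [hut]; simp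
    have h2 : i ∉ A ∩ pattern x t f := by rw [hut]; simpa using hij
    simp only [Finset.mem_inter, mem_pattern, not_and] at h1 h2
    have := h2 hi
    rw [hx] at this
    linarith [h1.2]
  intro i hi j hj hx
  rcases le_total (t i) (t j) with h | h
  · exact key i hi j hj hx h
  · exact (key j hj i hi hx.symm h).symm

open Classical in
lemma shatters_image_of_shatters_patterns {X ι : Type*} [Fintype ι] {F : Set (X → ℝ)} {x : ι → X}
    {t : ι → ℝ} {A : Finset ι} (hA : (patterns F x t).Shatters A) : Shatters F (A.image x) := by
  have hinj := injOn_of_shatters_patterns hA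
  have hz : ∀ i ∈ A, ∑ j ∈ A.filter (fun j => x j = x i), t j = t i := fun i hi => by
    rw [show A.filter (fun j => x j = x i) = {i} by
      ext j
      simp only [Finset.mem_filter, Finset.mem_singleton]
      exact ⟨fun h => hinj h.1 hi h.2, by rintro rfl; exact ⟨hi, rfl⟩⟩, Finset.sum_singleton]
  -- The witness at a point is the threshold of its only index in `A`; the sum over the fibre names
  -- it without a choice.
  refine ⟨fun p => ∑ j ∈ A.filter (fun j => x j = p), t j, fun T hT => ?_⟩
  obtain ⟨u, hu, hut⟩ := hA (Finset.filter_subset (fun i => x i ∈ T) A)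
  simp only [patterns, Finset.mem_filter, Finset.mem_univ, true_and] at hu
  obtain ⟨f, hf, rfl⟩ := hu
  refine ⟨f, hf, fun p hp => ?_⟩
  obtain ⟨i, hi, rfl⟩ := Finset.mem_image.1 hp
  have := congrArg (i ∈ ·) hut
  simp only [Finset.mem_inter, mem_pattern, Finset.mem_filter, hi, true_and, eq_iff_iff] at this
  simp only [hz i hi, this]

lemma card_le_of_pdim_eq {X : Type*} {F : Set (X → ℝ)} {d : ℕ} (hd : pdim F = d) {S : Finset X}
    (hS : Shatters F S) : S.card ≤ d := by
  have : ((S.card : ℕ) : ℕ∞) ≤ d := by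
    rw [← hd]
    exact le_iSup (fun S : {S : Finset X // Shatters F S} => (S.1.card : ℕ∞)) ⟨S, hS⟩
  exact_mod_cast this

/-- The Sauer–Shelah lemma for the pseudo-dimension. -/
lemma card_patterns_le {X ι : Type*} [Fintype ι] {F : Set (X → ℝ)} {d : ℕ} (hd : pdim F = d)
    (x : ι → X) (t : ι → ℝ) :
    (patterns F x t).card ≤ ∑ k ∈ Finset.range (d + 1), (Fintype.card ι).choose k := by
  classical
  have hvc : (patterns F x t).vcDim ≤ d := by
    refine Finset.sup_le fun A hA => ?_
    have hA := Finset.mem_shatterer.1 hA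
    rw [← Finset.card_image_of_injOn (injOn_of_shatters_patterns hA)]
    exact card_le_of_pdim_eq hd (shatters_image_of_shatters_patterns hA)
  refine (Finset.card_le_card_shatterer _).trans (Finset.card_shatterer_le_sum_vcDim.trans ?_)
  refine Finset.sum_le_sum_of_subset fun k hk => ?_
  simp only [Finset.mem_Iic, Finset.mem_range] at *
  omega

/-- With `q = d / M ≤ 1`, weighting the sum by `q ^ d ≤ q ^ k` leaves part of the binomial expansion
of `(1 + q) ^ m ≤ exp (q * m) ≤ exp d`. The parameter `M` is separate from `m` so that `m < d` is
allowed. -/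
lemma sum_choose_le_pow {m d : ℕ} {M : ℝ} (hm : (m : ℝ) ≤ M) (hd : (d : ℝ) ≤ M) :
    ((∑ k ∈ Finset.range (d + 1), m.choose k : ℕ) : ℝ) ≤ (Real.exp 1 * M / d) ^ d := by
  rcases Nat.eq_zero_or_pos d with rfl | hd0
  · simp
  have hd0' : (0 : ℝ) < d := by exact_mod_cast hd0
  have hM : 0 < M := hd0'.trans_le hd
  set q : ℝ := d / M with hq
  have hq0 : 0 < q := by positivity
  have hq1 : q ≤ 1 := (div_le_one hM).2 hd
  have h1 : q ^ d * ((∑ k ∈ Finset.range (d + 1), m.choose k : ℕ) : ℝ) ≤ (1 + q) ^ m := by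
    push_cast
    rw [Finset.mul_sum, add_comm 1 q, add_pow]
    have h2 : ∀ k ∈ Finset.range (d + 1), q ^ d * (m.choose k : ℝ)
        ≤ q ^ k * (m.choose k : ℝ) := fun k hk => by
      have : k ≤ d := by simpa [Nat.lt_succ_iff] using hk
      gcongr ?_ * _
      exact pow_le_pow_of_le_one hq0.le hq1 this
    refine (Finset.sum_le_sum h2).trans ?_
    calc ∑ k ∈ Finset.range (d + 1), q ^ k * (m.choose k : ℝ)
        = ∑ k ∈ (Finset.range (d + 1)).filter (· ≤ m), q ^ k * (m.choose k : ℝ) := by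
          rw [Finset.sum_filter_of_ne]
          intro k _ hk
          by_contra hkm
          exact hk (by rw [Nat.choose_eq_zero_of_lt (not_le.1 hkm)]; simp)
      _ ≤ ∑ k ∈ Finset.range (m + 1), q ^ k * (m.choose k : ℝ) := by
          refine Finset.sum_le_sum_of_subset_of_nonneg (fun k hk => ?_) fun _ _ _ => by positivity
          simp only [Finset.mem_filter, Finset.mem_range] at *
          omega
      _ = _ := by simp
  have h3 : (1 + q) ^ m ≤ Real.exp 1 ^ d := by
    calc (1 + q) ^ m ≤ Real.exp q ^ m := by
          gcongr
          linarith [Real.add_one_le_exp q]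
      _ = Real.exp (m * q) := by rw [← Real.exp_nat_mul]
      _ ≤ Real.exp (d * 1) := by
          apply Real.exp_le_exp.2
          calc m * q ≤ M * q := by gcongr
            _ = d * 1 := by rw [hq]; field_simp
      _ = Real.exp 1 ^ d := by rw [← Real.exp_nat_mul]
  have h4 : Real.exp 1 * M / d = Real.exp 1 / q := by rw [hq]; field_simp
  rw [h4, div_pow, le_div_iff₀ (by positivity), mul_comm]
  exact h1.trans h3

/-! ### The size of the greedy cover -/

/-- If every threshold of a grid of width `w` on `[-1, 1]` separates neither `a` nor `b`, then `a`
and `b` have distance less than `w`. -/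
lemma abs_sub_lt_of_same_grid_pattern {w a b : ℝ} {K : ℕ} (hw : 0 < w) (hK : 2 / w < K + 1)
    (ha : a ∈ Set.Icc (-1 : ℝ) 1) (hb : b ∈ Set.Icc (-1 : ℝ) 1)
    (h : ∀ k : Fin K, -1 + ((k : ℕ) + 1) * w ≤ a ↔ -1 + ((k : ℕ) + 1) * w ≤ b) : |a - b| < w := by
  have key : ∀ a b : ℝ, a ∈ Set.Icc (-1 : ℝ) 1 → b ∈ Set.Icc (-1 : ℝ) 1 →
      (∀ k : Fin K, -1 + ((k : ℕ) + 1) * w ≤ a → -1 + ((k : ℕ) + 1) * w ≤ b) → a - b < w := by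
    intro a b ha hb h
    by_contra! hab
    -- The point `-1 + k * w` is the last grid point not above `a`; if `b` reaches it, then `a - b <
    -- w`. For `k = 0` it is `-1`, which `b` always reaches; otherwise its index in `Fin K` is `k -
    -- 1`.
    set k := ⌊(a + 1) / w⌋₊ with hk
    have hk1 : (k : ℝ) * w ≤ a + 1 := by
      rw [← le_div_iff₀ hw]; exact Nat.floor_le (div_nonneg (by linarith [ha.1]) hw.le)
    have hk2 : a + 1 < (k + 1) * w := by
      rw [← div_lt_iff₀ hw]; exact Nat.lt_floor_add_one _
    have hk0 : 0 < k := by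
      rcases Nat.eq_zero_or_pos k with h0 | h0
      · rw [h0] at hk2
        push_cast at hk2
        linarith [hb.1]
      · exact h0
    have hkK : k < K + 1 := by
      have : (k : ℝ) < K + 1 := by
        refine lt_of_le_of_lt ?_ hK
        rw [le_div_iff₀ hw]
        linarith [ha.2]
      exact_mod_cast this
    obtain ⟨l, hl⟩ : ∃ l, k = l + 1 := ⟨k - 1, by omega⟩
    have hl' : (k : ℝ) = l + 1 := by exact_mod_cast hl
    have := h ⟨l, by omega⟩ (by
      show -1 + ((l : ℝ) + 1) * w ≤ a
      rw [← hl']; linarith)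
    change -1 + ((l : ℝ) + 1) * w ≤ b at this
    rw [← hl'] at this
    nlinarith
  rw [abs_lt]
  constructor
  · linarith [key b a hb ha fun k => (h k).2]
  · exact key a b ha hb fun k => (h k).1

/-- The states of the greedy algorithm: `V` and `G` correspond, and any two selected vectors have
`ℓ₁` distance at least `ε`. -/
lemma greedy_invariant {N : ℕ} {P : Type*} {B : (Fin N → ℝ) → ℝ → Set (Fin N → ℝ)}
    {vec : P → Fin N → ℝ} {ε : ℝ} (hB : B = openBall ∨ B = closedBall)
    {s : Finset (Fin N → ℝ) × Finset P}
    (h : Relation.ReflTransGen (GreedyStep B vec ε) (∅, ∅) s) :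
    (∀ p ∈ s.2, vec p ∈ s.1) ∧ (∀ v ∈ s.1, ∃ p ∈ s.2, vec p = v) ∧
      ∀ p ∈ s.2, ∀ q ∈ s.2, p ≠ q → ε ≤ ∑ j, |vec p j - vec q j| := by
  induction h with
  | refl => simp
  | @tail s s' _ hstep ih =>
    obtain ⟨v', hv', p, rfl, rfl⟩ := hstep
    obtain ⟨ih1, ih2, ih3⟩ := ih
    have hfar : ∀ q ∈ s.2, ε ≤ ∑ j, |vec p j - vec q j| := by
      intro q hq
      have h1 : vec p ∉ B (vec q) ε := fun hmem =>
        hv'.2 (Set.mem_biUnion (ih1 q hq) hmem)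
      rcases hB with rfl | rfl
      · simpa [openBall] using h1
      · simp only [closedBall, Set.mem_ofPred_eq, not_le] at h1
        exact h1.le
    refine ⟨?_, ?_, ?_⟩
    · intro q hq
      simp only [Finset.mem_insert] at hq ⊢
      rcases hq with rfl | hq
      · exact Or.inl rfl
      · exact Or.inr (ih1 q hq)
    · intro v hv
      simp only [Finset.mem_insert] at hv
      rcases hv with rfl | hv
      · exact ⟨p, by simp, rfl⟩
      · obtain ⟨q, hq, hqv⟩ := ih2 v hv
        exact ⟨q, by simp [hq], hqv⟩
    · intro q hq r hr hqr
      simp only [Finset.mem_insert] at hq hr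
      rcases hq with rfl | hq <;> rcases hr with rfl | hr
      · exact absurd rfl hqr
      · exact hfar r hr
      · simp_rw [abs_sub_comm (vec q _)]
        exact hfar q hq
      · exact ih3 q hq r hr hqr

/-- Each step of the greedy algorithm adds a new pair. -/
lemma greedyStep_card {N : ℕ} {P : Type*} {B : (Fin N → ℝ) → ℝ → Set (Fin N → ℝ)}
    {vec : P → Fin N → ℝ} {ε : ℝ} (hε : 0 < ε) (hB : B = openBall ∨ B = closedBall)
    {s s' : Finset (Fin N → ℝ) × Finset P}
    (h : Relation.ReflTransGen (GreedyStep B vec ε) (∅, ∅) s) (hstep : GreedyStep B vec ε s s') :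
    s'.2.card = s.2.card + 1 := by
  obtain ⟨v', hv', p, rfl, rfl⟩ := hstep
  classical
  -- A pair selected earlier has its vector at the centre of a ball of positive radius, hence
  -- covered.
  have hp : p ∉ s.2 := fun hp => by
    refine hv'.2 (Set.mem_biUnion ((greedy_invariant hB h).1 p hp) ?_)
    rcases hB with rfl | rfl
    · simpa [openBall] using hε
    · simpa [closedBall] using hε.le
  convert Finset.card_insert_of_notMem hp

/-- A set of pairs whose gain vectors are `ε`-separated is at most as large as the square of the
number of threshold patterns on a grid of width `ε / 2`. -/
lemma card_le_of_separated {n N : ℕ} {Θ : Fin n → Type*} {O : Type*}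
    {util : Fin n → Profile Θ → O → ℝ} {Ms : Set (Mechanism Θ O)} {ε : ℝ} (hN : 0 < N)
    (hε : 0 < ε) {i : Fin n} {M : Mechanism Θ O} (hM : M ∈ Ms)
    (hu : ∀ θ θ', utility util i M θ θ' ∈ Set.Icc (-1 : ℝ) 1)
    (x : Fin N → Others Θ i) {G : Finset (Θ i × Θ i)}
    (hG : ∀ p ∈ G, ∀ q ∈ G, p ≠ q →
      ε ≤ ∑ j, |gainVector util i M x p j - gainVector util i M x q j|) :
    G.card ≤ (patterns (utilityClass util Ms i)
      (fun a : Fin N × Fin ⌊4 / ε⌋₊ => x a.1)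
      (fun a => -1 + ((a.2 : ℕ) + 1) * (ε / 2))).card ^ 2 := by
  set y : Fin N × Fin ⌊4 / ε⌋₊ → Others Θ i := fun a => x a.1 with hy
  set t : Fin N × Fin ⌊4 / ε⌋₊ → ℝ := fun a => -1 + ((a.2 : ℕ) + 1) * (ε / 2) with ht
  set u := utilityTruthfulOthers util i M with hu'
  have hN' : (0 : ℝ) < N := by exact_mod_cast hN
  rw [sq, ← Finset.card_product]
  -- Equal patterns bring each of the two utilities within `ε / 2` at every sample point, so each
  -- coordinate of the gain vectors differs by less than `ε / N`, against the separation.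
  refine Finset.card_le_card_of_injOn (fun p => (pattern y t (u p.1 p.2), pattern y t (u p.1 p.1)))
    (fun p _ => ?_) fun p hp q hq hpq => ?_
  · simp only [Finset.coe_product, Set.mem_prod, Finset.mem_coe]
    exact ⟨pattern_mem_patterns y t ⟨M, hM, _, _, rfl⟩,
      pattern_mem_patterns y t ⟨M, hM, _, _, rfl⟩⟩
  · by_contra hne
    simp only [Prod.mk.injEq] at hpq
    have hclose : ∀ a b c e : Θ i, pattern y t (u a b) = pattern y t (u c e) → ∀ j,
        |u a b (x j) - u c e (x j)| < ε / 2 := by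
      intro a b c e hpat j
      refine abs_sub_lt_of_same_grid_pattern (K := ⌊4 / ε⌋₊) (by positivity) ?_ (hu _ _) (hu _ _)
        fun k => ?_
      · calc 2 / (ε / 2) = 4 / ε := by field_simp; norm_num
          _ < _ := Nat.lt_floor_add_one _
      · have := congrArg ((j, k) ∈ ·) hpat
        simpa only [mem_pattern, eq_iff_iff] using this
    refine absurd (hG p hp q hq hne) (not_le.2 ?_)
    calc ∑ j, |gainVector util i M x p j - gainVector util i M x q j|
        < ∑ _j : Fin N, 1 / (N : ℝ) * ε := by
          refine Finset.sum_lt_sum_of_nonempty ⟨⟨0, hN⟩, Finset.mem_univ _⟩ fun j _ => ?_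
          have h1 := hclose _ _ _ _ hpq.1 j
          have h2 := hclose _ _ _ _ hpq.2 j
          rw [gainVector, gainVector, ← mul_sub, abs_mul, abs_of_pos (by positivity)]
          gcongr
          rw [abs_lt] at *
          constructor <;> linarith [h1.1, h1.2, h2.1, h2.2]
      _ = ε := by
          rw [Finset.sum_const, Finset.card_univ, Fintype.card_fin, nsmul_eq_mul]
          field_simp

/-- Along a run the `k`-th state has `k` separated pairs, while separated sets have bounded size. -/
lemma greedyTerminates {n N : ℕ} {Θ : Fin n → Type*} {O : Type*}
    {util : Fin n → Profile Θ → O → ℝ} {Ms : Set (Mechanism Θ O)} {ε : ℝ}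
    {B : (Fin N → ℝ) → ℝ → Set (Fin N → ℝ)} (hB : B = openBall ∨ B = closedBall) (hN : 0 < N)
    (hε : 0 < ε) {i : Fin n} {M : Mechanism Θ O} (hM : M ∈ Ms)
    (hu : ∀ θ θ', utility util i M θ θ' ∈ Set.Icc (-1 : ℝ) 1) (x : Fin N → Others Θ i) :
    GreedyTerminates B (gainVector util i M x) ε := by
  rintro ⟨s, hs0, hs⟩
  have hreach : ∀ k, Relation.ReflTransGen (GreedyStep B (gainVector util i M x) ε) (∅, ∅) (s k) := by
    intro k
    induction k with
    | zero => rw [hs0]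
    | succ k ih => exact ih.tail (hs k)
  have hcard : ∀ k, (s k).2.card = k := by
    intro k
    induction k with
    | zero => simp [hs0]
    | succ k ih => rw [greedyStep_card hε hB (hreach k) (hs k), ih]
  have hbound := fun k => card_le_of_separated hN hε hM hu x
    (greedy_invariant hB (hreach k)).2.2
  simp only [hcard] at hbound
  -- The bound does not depend on `k`, so it fails for the `k` one larger than itself.
  exact absurd (hbound _) (Nat.not_succ_le_self _)

lemma greedyReturns_card_le {n N : ℕ} {Θ : Fin n → Type*} {O : Type*}
    {util : Fin n → Profile Θ → O → ℝ} {Ms : Set (Mechanism Θ O)} {ε : ℝ}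
    {B : (Fin N → ℝ) → ℝ → Set (Fin N → ℝ)} (hB : B = openBall ∨ B = closedBall) (hN : 0 < N)
    (hε : 0 < ε) {i : Fin n} {M : Mechanism Θ O} (hM : M ∈ Ms)
    (hu : ∀ θ θ', utility util i M θ θ' ∈ Set.Icc (-1 : ℝ) 1) (x : Fin N → Others Θ i) {d : ℕ}
    (hd : pdim (utilityClass util Ms i) = d) (hεd : ε * d ≤ 8 * N) {G : Finset (Θ i × Θ i)}
    (hG : GreedyReturns B (gainVector util i M x) ε G) :
    (G.card : ℝ) ≤ (8 * Real.exp 1 * N / (ε * d)) ^ (2 * d) := by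
  obtain ⟨V, hV, -⟩ := hG
  have h1 := (card_le_of_separated hN hε hM hu x (greedy_invariant hB hV).2.2).trans
    (Nat.pow_le_pow_left (card_patterns_le hd _ _) 2)
  -- There are at most `4 * N / ε` thresholds. The larger value `8 * N / ε` is used because `hεd`
  -- says that it is at least `d`.
  have h2 := sum_choose_le_pow (m := Fintype.card (Fin N × Fin ⌊4 / ε⌋₊)) (d := d)
    (M := 8 * N / ε) (by
      simp only [Fintype.card_prod, Fintype.card_fin, Nat.cast_mul]
      calc (N : ℝ) * (⌊4 / ε⌋₊ : ℝ) ≤ N * (4 / ε) := by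
            gcongr
            exact Nat.floor_le (by positivity)
        _ = 4 * N / ε := by ring
        _ ≤ 8 * N / ε := by gcongr; norm_num) (by
      rw [le_div_iff₀ hε]
      linarith)
  calc (G.card : ℝ) ≤ (((∑ k ∈ Finset.range (d + 1),
        (Fintype.card (Fin N × Fin ⌊4 / ε⌋₊)).choose k) ^ 2 : ℕ) : ℝ) := Nat.cast_le.2 h1
    _ ≤ ((Real.exp 1 * (8 * N / ε) / d) ^ d) ^ 2 := by
      push_cast at h2 ⊢
      gcongr
    _ = _ := by
      rw [← pow_mul, mul_comm d 2]
      congr 1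
      rw [← div_div]
      ring

/-! ### Exponential moments of Rademacher averages -/

/-- The sign that a Boolean encodes. -/
def boolSign (b : Bool) : ℝ := if b then 1 else -1

lemma abs_boolSign (b : Bool) : |boolSign b| = 1 := by
  cases b <;> simp [boolSign]

/-- The sum over sign vectors, `2 ^ N` times an expectation, factors into terms `2 * cosh (a * c
j)`, and `cosh t ≤ exp (t ^ 2 / 2)`. -/
lemma sum_exp_rademacher_le {N : ℕ} (a : ℝ) {c : Fin N → ℝ} (hc : ∀ j, |c j| ≤ 1) :
    ∑ s : Fin N → Bool, Real.exp (a * ∑ j, boolSign (s j) * c j)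
      ≤ 2 ^ N * Real.exp (a ^ 2 * N / 2) := by
  have h1 : ∑ s : Fin N → Bool, Real.exp (a * ∑ j, boolSign (s j) * c j)
      = ∏ j, ∑ b : Bool, Real.exp (a * (boolSign b * c j)) := by
    rw [Finset.prod_univ_sum, Fintype.piFinset_univ]
    simp_rw [Finset.mul_sum, Real.exp_sum]
  have h2 : ∀ j, ∑ b : Bool, Real.exp (a * (boolSign b * c j))
      ≤ 2 * Real.exp (a ^ 2 / 2) := fun j => by
    have h := Real.cosh_le_exp_half_sq (a * c j)
    rw [Real.cosh_eq] at h
    have h' : Real.exp ((a * c j) ^ 2 / 2) ≤ Real.exp (a ^ 2 / 2) := by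
      apply Real.exp_le_exp.2
      have := (sq_le_one_iff_abs_le_one (c j)).2 (hc j)
      rw [mul_pow]
      nlinarith [sq_nonneg a]
    simp only [Fintype.sum_bool, boolSign]
    simp only [if_true, Bool.false_eq_true, if_false, one_mul, neg_one_mul, mul_neg]
    linarith
  rw [h1]
  refine (Finset.prod_le_prod (fun j _ => by positivity) fun j _ => h2 j).trans_eq ?_
  rw [Finset.prod_const, Finset.card_univ, Fintype.card_fin, mul_pow, ← Real.exp_nat_mul]
  ring_nf

/-- A number in `[-1, 1]` is up to `2 / K` an average of `K` threshold indicators. -/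
lemma abs_sub_sum_thresholds_le {K : ℕ} (hK : 0 < K) {v : ℝ} (hv : v ∈ Set.Icc (-1 : ℝ) 1) :
    |v + 1 - 2 / K * ∑ k : Fin K, (if -1 + 2 * (((k : ℕ) : ℝ) + 1) / K ≤ v then (1 : ℝ) else 0)|
      ≤ 2 / K := by
  have hK' : (0 : ℝ) < K := by exact_mod_cast hK
  -- This is the number of thresholds that `v` reaches.
  set m := ⌊(v + 1) * K / 2⌋₊ with hm
  have hnn : 0 ≤ (v + 1) * K / 2 := by
    have := hv.1
    have : 0 ≤ v + 1 := by linarith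
    positivity
  have hm1 : (m : ℝ) ≤ (v + 1) * K / 2 := Nat.floor_le hnn
  have hm2 : (v + 1) * K / 2 < m + 1 := Nat.lt_floor_add_one _
  have hmK : m ≤ K := by
    have : (m : ℝ) ≤ K := by nlinarith [hv.2]
    exact_mod_cast this
  have hsum : ∑ k : Fin K, (if -1 + 2 * (((k : ℕ) : ℝ) + 1) / K ≤ v then (1 : ℝ) else 0) = m := by
    rw [Fin.sum_univ_eq_sum_range
      (fun k => if -1 + 2 * ((k : ℝ) + 1) / K ≤ v then (1 : ℝ) else 0)]
    have : ∀ k : ℕ, (-1 + 2 * ((k : ℝ) + 1) / K ≤ v) ↔ k < m := fun k => by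
      rw [← Nat.succ_le_iff, hm, Nat.le_floor_iff hnn, Nat.succ_eq_add_one, le_div_iff₀ two_pos,
        ← div_le_iff₀ hK', neg_add_le_iff_le_add, add_comm 1 v]
      push_cast
      rw [mul_comm]
    simp_rw [this]
    rw [Finset.sum_ite, Finset.sum_const_zero, add_zero, Finset.sum_const, nsmul_eq_mul, mul_one]
    congr 1
    rw [show (Finset.range K).filter (· < m) = Finset.range m by
      ext k; simp only [Finset.mem_filter, Finset.mem_range]; omega, Finset.card_range]
  rw [hsum, abs_le]
  have h1 : 2 / K * m ≤ v + 1 := by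
    rw [div_mul_eq_mul_div, div_le_iff₀ hK']; linarith
  have h2 : v + 1 ≤ 2 / K * m + 2 / K := by
    rw [div_mul_eq_mul_div, ← add_div, le_div_iff₀ hK']; linarith
  have h3 : 0 ≤ 2 / (K : ℝ) := by positivity
  constructor <;> linarith

open Classical in
/-- The signed sum of the increments of the indicator of `A`. -/
noncomputable def signedCount {N : ℕ} (s : Fin N → Bool) (A : Finset (Fin N ⊕ Fin N)) : ℝ :=
  ∑ j, boolSign (s j) *
    ((if Sum.inl j ∈ A then (1 : ℝ) else 0) - (if Sum.inr j ∈ A then (1 : ℝ) else 0))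

lemma sum_exp_abs_signedCount_le {N : ℕ} (a : ℝ) (A : Finset (Fin N ⊕ Fin N)) :
    ∑ s : Fin N → Bool, Real.exp (a * |signedCount s A|)
      ≤ 2 ^ N * (2 * Real.exp (a ^ 2 * N / 2)) := by
  classical
  have hc : ∀ j : Fin N, |(if Sum.inl j ∈ A then (1 : ℝ) else 0)
      - (if Sum.inr j ∈ A then (1 : ℝ) else 0)| ≤ 1 := fun j => by
    split_ifs <;> simp
  have h1 := sum_exp_rademacher_le a hc
  have h2 := sum_exp_rademacher_le (-a) hc
  calc ∑ s : Fin N → Bool, Real.exp (a * |signedCount s A|)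
      ≤ ∑ s : Fin N → Bool, (Real.exp (a * signedCount s A)
          + Real.exp (-a * signedCount s A)) := by
        refine Finset.sum_le_sum fun s _ => ?_
        rcases abs_cases (signedCount s A) with ⟨h, -⟩ | ⟨h, -⟩ <;> rw [h]
        · linarith [Real.exp_pos (-a * signedCount s A)]
        · rw [mul_neg, neg_mul]
          linarith [Real.exp_pos (a * signedCount s A)]
    _ ≤ _ := by
        rw [Finset.sum_add_distrib]
        unfold signedCount
        rw [neg_sq] at h2
        linarith

/-- The signed sum over a ghost sample is an average of signed counts of threshold patterns. -/
lemma abs_signed_sum_le {X : Type*} {N K : ℕ} (hK : 0 < K) {f : X → ℝ}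
    (hf : ∀ x, f x ∈ Set.Icc (-1 : ℝ) 1) (y : Fin N ⊕ Fin N → X) (s : Fin N → Bool) :
    |∑ j, boolSign (s j) * (f (y (Sum.inl j)) - f (y (Sum.inr j)))|
      ≤ 4 * N / K + 2 / K * ∑ k : Fin K,
        |signedCount s (pattern y (fun _ => -1 + 2 * (((k : ℕ) : ℝ) + 1) / K) f)| := by
  classical
  -- `g` discretizes `f + 1`; the shift cancels in differences, and each of the `N` differences
  -- changes by at most `4 / K`.
  set g : X → ℝ := fun x =>
    2 / K * ∑ k : Fin K, (if -1 + 2 * (((k : ℕ) : ℝ) + 1) / K ≤ f x then (1 : ℝ) else 0) with hg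
  have hfg : ∀ x, |f x + 1 - g x| ≤ 2 / K := fun x => abs_sub_sum_thresholds_le hK (hf x)
  have h1 : ∑ j, boolSign (s j) * (g (y (Sum.inl j)) - g (y (Sum.inr j)))
      = 2 / K * ∑ k : Fin K,
        signedCount s (pattern y (fun _ => -1 + 2 * (((k : ℕ) : ℝ) + 1) / K) f) := by
    simp only [hg, signedCount, mem_pattern, ← mul_sub, ← Finset.sum_sub_distrib]
    rw [Finset.sum_comm, Finset.mul_sum]
    refine Finset.sum_congr rfl fun j _ => ?_
    rw [← Finset.mul_sum]
    ring
  have h2 : ∑ j, boolSign (s j) * (f (y (Sum.inl j)) - f (y (Sum.inr j)))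
      = ∑ j, boolSign (s j) * (g (y (Sum.inl j)) - g (y (Sum.inr j)))
        + ∑ j, boolSign (s j) * ((f (y (Sum.inl j)) + 1 - g (y (Sum.inl j)))
          - (f (y (Sum.inr j)) + 1 - g (y (Sum.inr j)))) := by
    rw [← Finset.sum_add_distrib]
    exact Finset.sum_congr rfl fun j _ => by ring
  have h3 : |∑ j, boolSign (s j) * ((f (y (Sum.inl j)) + 1 - g (y (Sum.inl j)))
      - (f (y (Sum.inr j)) + 1 - g (y (Sum.inr j))))| ≤ 4 * N / K := by
    calc _ ≤ ∑ _j : Fin N, (2 / (K : ℝ) + 2 / K) := by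
          refine (Finset.abs_sum_le_sum_abs _ _).trans (Finset.sum_le_sum fun j _ => ?_)
          rw [abs_mul, abs_boolSign, one_mul]
          exact (abs_sub _ _).trans (add_le_add (hfg _) (hfg _))
      _ = _ := by
          rw [Finset.sum_const, Finset.card_univ, Fintype.card_fin, nsmul_eq_mul]
          ring
  rw [h2, h1]
  refine (abs_add_le _ _).trans ?_
  rw [abs_mul, abs_of_nonneg (by positivity : (0 : ℝ) ≤ 2 / K), add_comm]
  gcongr
  exact Finset.abs_sum_le_sum_abs _ _

/-- A bound on the exponential moment of the supremum of the signed sums over a fixed ghost sample,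
for a class all of whose families of threshold patterns have at most `R` elements. -/
lemma exists_exp_signed_sum_bound {X : Type*} {N : ℕ} {F : Set (X → ℝ)}
    (hF : ∀ f ∈ F, ∀ x, f x ∈ Set.Icc (-1 : ℝ) 1) (y : Fin N ⊕ Fin N → X) {R : ℝ}
    (hR : ∀ t, ((patterns F y t).card : ℝ) ≤ R) {a : ℝ} (ha : 0 ≤ a) :
    ∃ W : (Fin N → Bool) → ℝ,
      (∀ s, ∀ f ∈ F, Real.exp (a * |∑ j, boolSign (s j) *
        (f (y (Sum.inl j)) - f (y (Sum.inr j)))|) ≤ W s) ∧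
      ∑ s, W s ≤ 2 ^ N * (2 * Real.exp 1 * R * Real.exp (2 * a ^ 2 * N)) := by
  -- So fine a discretization costs only a factor `exp 1`.
  set K : ℕ := ⌈4 * N * a⌉₊ + 1 with hK
  have hK0 : 0 < K := Nat.succ_pos _
  have hK' : (0 : ℝ) < K := by exact_mod_cast hK0
  have hKa : a * (4 * N / K) ≤ 1 := by
    rw [mul_div_assoc', div_le_one hK', hK]
    push_cast
    linarith [Nat.le_ceil (4 * N * a)]
  set P : Fin K → Finset (Finset (Fin N ⊕ Fin N)) := fun k =>
    patterns F y (fun _ => -1 + 2 * (((k : ℕ) : ℝ) + 1) / K) with hP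
  -- At each level the sum over all patterns dominates the term of any single `f`. The weights `2 /
  -- K` average doubled counts, hence `2 * a` and finally `(2 * a) ^ 2 * N / 2`.
  refine ⟨fun s => Real.exp 1 * ∑ k, 1 / (K : ℝ) *
    ∑ A ∈ P k, Real.exp (2 * a * |signedCount s A|), fun s f hf => ?_, ?_⟩
  · set q : Fin K → ℝ := fun k =>
      |signedCount s (pattern y (fun _ => -1 + 2 * (((k : ℕ) : ℝ) + 1) / K) f)| with hq
    have h1 := abs_signed_sum_le hK0 (hF f hf) y s
    calc _ ≤ Real.exp (1 + ∑ k, 1 / (K : ℝ) * (2 * a * q k)) := by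
          apply Real.exp_le_exp.2
          refine (mul_le_mul_of_nonneg_left h1 ha).trans ?_
          rw [mul_add]
          refine add_le_add hKa (le_of_eq ?_)
          rw [Finset.mul_sum, Finset.mul_sum]
          exact Finset.sum_congr rfl fun k _ => by ring
      _ ≤ Real.exp 1 * ∑ k, 1 / (K : ℝ) * Real.exp (2 * a * q k) := by
          rw [Real.exp_add]
          gcongr
          have := convexOn_exp.map_sum_le (t := Finset.univ) (w := fun _ : Fin K => 1 / (K : ℝ))
            (p := fun k => 2 * a * q k) (fun _ _ => by positivity)
            (by simp [hK'.ne']) (fun _ _ => Set.mem_univ _)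
          simpa only [smul_eq_mul] using this
      _ ≤ _ := by
          refine mul_le_mul_of_nonneg_left (Finset.sum_le_sum fun k _ =>
            mul_le_mul_of_nonneg_left ?_ (by positivity)) (by positivity)
          exact Finset.single_le_sum (f := fun A => Real.exp (2 * a * |signedCount s A|))
            (fun _ _ => by positivity) (pattern_mem_patterns y _ hf)
  · have hk : ∀ k, ∑ s : Fin N → Bool, ∑ A ∈ P k, Real.exp (2 * a * |signedCount s A|)
        ≤ R * (2 ^ N * (2 * Real.exp (2 * a ^ 2 * N))) := fun k => by
      rw [Finset.sum_comm]
      calc _ ≤ ∑ _A ∈ P k, 2 ^ N * (2 * Real.exp (2 * a ^ 2 * N)) := by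
            refine Finset.sum_le_sum fun A _ => (sum_exp_abs_signedCount_le _ A).trans_eq ?_
            ring_nf
        _ ≤ _ := by
            rw [Finset.sum_const, nsmul_eq_mul]
            gcongr
            exact hR _
    rw [← Finset.mul_sum, Finset.sum_comm]
    simp_rw [← Finset.mul_sum]
    calc _ ≤ Real.exp 1 * (1 / (K : ℝ) * ∑ _k : Fin K,
          R * (2 ^ N * (2 * Real.exp (2 * a ^ 2 * N)))) := by
          gcongr with k
          exact hk k
      _ = _ := by
          rw [Finset.sum_const, Finset.card_univ, Fintype.card_fin, nsmul_eq_mul]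
          field_simp

/-! ### Symmetrization -/

/-- The supremum over the class of the absolute values of the signed sums over `y`. -/
noncomputable def signedSup {X ι : Type*} [Fintype ι] (F : Set (X → ℝ)) (τ : ι → ℝ) (y : ι → X) :
    ℝ :=
  ⨆ f : F, |∑ i, τ i * f.1 (y i)|

lemma signedSup_comp_equiv {X ι κ : Type*} [Fintype ι] [Fintype κ] (F : Set (X → ℝ)) (τ : ι → ℝ)
    (y : ι → X) (e : κ ≃ ι) : signedSup F (τ ∘ e) (y ∘ e) = signedSup F τ y := by
  unfold signedSup
  congr 1
  funext f
  rw [← Equiv.sum_comp e]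
  rfl

lemma abs_signed_le_signedSup {X ι : Type*} [Fintype ι] {F : Set (X → ℝ)}
    (hF : ∀ f ∈ F, ∀ x, f x ∈ Set.Icc (-1 : ℝ) 1) {τ : ι → ℝ} (y : ι → X) {f : X → ℝ}
    (hf : f ∈ F) : |∑ i, τ i * f (y i)| ≤ signedSup F τ y := by
  -- Boundedness matters: the real supremum of an unbounded family is `0`.
  refine le_ciSup (f := fun f : F => |∑ i, τ i * f.1 (y i)|) ⟨∑ i, |τ i|, ?_⟩ ⟨f, hf⟩
  rintro _ ⟨g, rfl⟩
  refine (Finset.abs_sum_le_sum_abs _ _).trans (Finset.sum_le_sum fun i _ => ?_)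
  rw [abs_mul]
  exact mul_le_of_le_one_right (abs_nonneg _) (abs_le.2 (hF g.1 g.2 _))

lemma measurePreserving_comp_equiv {X ι κ : Type*} [Fintype ι] [Fintype κ] [MeasurableSpace X]
    (μ : Measure X) [IsProbabilityMeasure μ] (e : κ ≃ ι) :
    MeasurePreserving (fun y : ι → X => y ∘ e) (Measure.pi fun _ => μ)
      (Measure.pi fun _ => μ) := by
  have h := measurePreserving_piCongrLeft (α := fun _ : κ => X) (fun _ => μ) e.symm
  convert h using 1
  funext y k
  rw [MeasurableEquiv.coe_piCongrLeft, Equiv.piCongrLeft_apply]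
  simp

/-- Relabelling extends the hypothesis to the index type `Fin N ⊕ Fin N` of the ghost sample. -/
lemma IsMeasurableClass.aemeasurable_signedSup {X ι : Type*} [Fintype ι] [MeasurableSpace X]
    {μ : Measure X} [IsProbabilityMeasure μ] {F : Set (X → ℝ)} (h : IsMeasurableClass μ F)
    {τ : ι → ℝ} (hτ : ∀ i, τ i = 1 ∨ τ i = -1) :
    AEMeasurable (signedSup F τ) (Measure.pi fun _ => μ) := by
  set e := (Fintype.equivFin ι).symm
  have h1 : AEMeasurable (signedSup F (τ ∘ e)) (Measure.pi fun _ => μ) :=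
    h _ (τ ∘ e) fun j => hτ _
  have h2 := h1.comp_quasiMeasurePreserving (measurePreserving_comp_equiv μ e).quasiMeasurePreserving
  refine h2.congr (Filter.Eventually.of_forall fun y => ?_)
  exact signedSup_comp_equiv F τ y e

/-- Signs on a ghost sample: `s` on the first half and `-s` on the second half. -/
def ghostSign {N : ℕ} (s : Fin N → Bool) : Fin N ⊕ Fin N → ℝ :=
  Sum.elim (fun j => boolSign (s j)) (fun j => -boolSign (s j))

lemma ghostSign_eq {N : ℕ} (s : Fin N → Bool) (i : Fin N ⊕ Fin N) :
    ghostSign s i = 1 ∨ ghostSign s i = -1 := by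
  rcases i with j | j <;> cases h : s j <;> simp [ghostSign, boolSign, h]

lemma sum_ghostSign_mul {N : ℕ} (s : Fin N → Bool) (g : Fin N ⊕ Fin N → ℝ) :
    ∑ i, ghostSign s i * g i = ∑ j, boolSign (s j) * (g (Sum.inl j) - g (Sum.inr j)) := by
  rw [Fintype.sum_sum_type, ← Finset.sum_add_distrib]
  refine Finset.sum_congr rfl fun j _ => ?_
  simp only [ghostSign, Sum.elim_inl, Sum.elim_inr]
  ring

/-- Exchange the two copies of the indices at which `s` is negative. -/
def ghostSwap {N : ℕ} (s : Fin N → Bool) : Fin N ⊕ Fin N ≃ Fin N ⊕ Fin N :=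
  Function.Involutive.toPerm
    (fun i => if s (Sum.elim id id i) then i else i.swap) (by
      intro i
      rcases i with j | j <;> cases h : s j <;> simp [h])

lemma ghostSwap_apply {N : ℕ} (s : Fin N → Bool) (i : Fin N ⊕ Fin N) :
    ghostSwap s i = if s (Sum.elim id id i) then i else i.swap := rfl

/-- The swap preserves the i.i.d. law, so the signed supremum has the same law for all `s`. -/
lemma ghostSign_comp_ghostSwap {N : ℕ} (s : Fin N → Bool) :
    ghostSign s ∘ ghostSwap s = ghostSign fun _ => true := by
  funext i
  rcases i with j | j <;> cases h : s j <;>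
    simp [ghostSwap_apply, ghostSign, boolSign, h]

/-- Nonemptiness is essential: the supremum over the empty class is `0`, while `h` would not
constrain `W`. -/
lemma exp_mul_signedSup_le {X ι : Type*} [Fintype ι] {F : Set (X → ℝ)} (hne : F.Nonempty)
    {τ : ι → ℝ} {y : ι → X} {a W : ℝ} (ha : 0 ≤ a)
    (h : ∀ f ∈ F, Real.exp (a * |∑ i, τ i * f (y i)|) ≤ W) :
    Real.exp (a * signedSup F τ y) ≤ W := by
  obtain ⟨f₀, hf₀⟩ := hne
  have hW : 0 < W := (Real.exp_pos _).trans_le (h f₀ hf₀)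
  have : Nonempty F := ⟨⟨f₀, hf₀⟩⟩
  rw [← Real.le_log_iff_exp_le hW, signedSup, Real.mul_iSup_of_nonneg ha]
  exact ciSup_le fun f => (Real.le_log_iff_exp_le hW).2 (h f.1 f.2)

/-- All sign patterns give the same integral, so `2 ^ N` times it is the integral of the sum over
`s`, which is bounded pointwise on each fixed ghost sample. -/
lemma lintegral_exp_signedSup_le {X : Type*} [MeasurableSpace X] {μ : Measure X}
    [IsProbabilityMeasure μ] {N : ℕ} {F : Set (X → ℝ)} (hne : F.Nonempty)
    (hF : ∀ f ∈ F, ∀ x, f x ∈ Set.Icc (-1 : ℝ) 1) (hFm : IsMeasurableClass μ F) {R : ℝ}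
    (hR : ∀ (y : Fin N ⊕ Fin N → X) t, ((patterns F y t).card : ℝ) ≤ R) {a : ℝ} (ha : 0 ≤ a) :
    ∫⁻ y, ENNReal.ofReal (Real.exp (a * signedSup F (ghostSign fun _ : Fin N => true) y))
        ∂(Measure.pi fun _ : Fin N ⊕ Fin N => μ)
      ≤ ENNReal.ofReal (2 * Real.exp 1 * R * Real.exp (2 * a ^ 2 * N)) := by
  set ν : Measure (Fin N ⊕ Fin N → X) := Measure.pi fun _ => μ with hν
  set Φ : (Fin N → Bool) → (Fin N ⊕ Fin N → X) → ENNReal := fun s y =>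
    ENNReal.ofReal (Real.exp (a * signedSup F (ghostSign s) y)) with hΦ
  have hm : ∀ s, AEMeasurable (Φ s) ν := fun s =>
    ((hFm.aemeasurable_signedSup (ghostSign_eq s)).const_mul a).exp.ennreal_ofReal
  have hsym : ∀ s, ∫⁻ y, Φ s y ∂ν = ∫⁻ y, Φ (fun _ => true) y ∂ν := fun s => by
    have hmp := measurePreserving_comp_equiv μ (ghostSwap s)
    calc ∫⁻ y, Φ s y ∂ν = ∫⁻ y, Φ (fun _ => true) (y ∘ ghostSwap s) ∂ν := by
          refine lintegral_congr fun y => ?_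
          simp only [hΦ]
          rw [← ghostSign_comp_ghostSwap s, signedSup_comp_equiv]
      _ = ∫⁻ y, Φ (fun _ => true) y ∂(ν.map fun y => y ∘ ghostSwap s) := by
          rw [lintegral_map' _ hmp.measurable.aemeasurable]
          rw [hν, hmp.map_eq]
          exact hm _
      _ = _ := by rw [hν, hmp.map_eq]
  have hsum : ∀ y, ∑ s, Φ s y
      ≤ ENNReal.ofReal (2 ^ N * (2 * Real.exp 1 * R * Real.exp (2 * a ^ 2 * N))) := fun y => by
    obtain ⟨W, hW1, hW2⟩ := exists_exp_signed_sum_bound hF y (hR y) ha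
    simp only [hΦ]
    rw [← ENNReal.ofReal_sum_of_nonneg fun _ _ => (Real.exp_pos _).le]
    refine ENNReal.ofReal_le_ofReal ((Finset.sum_le_sum fun s _ => ?_).trans hW2)
    refine exp_mul_signedSup_le hne ha fun f hf => ?_
    rw [sum_ghostSign_mul s fun i => f (y i)]
    exact hW1 s f hf
  have h2 : (2 : ENNReal) ^ N * ∫⁻ y, Φ (fun _ => true) y ∂ν
      ≤ 2 ^ N * ENNReal.ofReal (2 * Real.exp 1 * R * Real.exp (2 * a ^ 2 * N)) := by
    calc (2 : ENNReal) ^ N * ∫⁻ y, Φ (fun _ => true) y ∂ν = ∑ s, ∫⁻ y, Φ s y ∂ν := by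
          simp_rw [hsym]
          simp
      _ = ∫⁻ y, ∑ s, Φ s y ∂ν := (lintegral_finsetSum' _ fun s _ => hm s).symm
      _ ≤ ∫⁻ _, ENNReal.ofReal (2 ^ N * (2 * Real.exp 1 * R * Real.exp (2 * a ^ 2 * N))) ∂ν :=
          lintegral_mono hsum
      _ = _ := by
          rw [lintegral_const, measure_univ, mul_one, ENNReal.ofReal_mul (by positivity),
            ENNReal.ofReal_pow (by norm_num)]
          simp
  exact (ENNReal.mul_le_mul_iff_right (by simp) (by simp)).1 h2

lemma measurePreserving_sumElim {X ι κ : Type*} [Fintype ι] [Fintype κ] [MeasurableSpace X]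
    (μ : Measure X) [IsProbabilityMeasure μ] :
    MeasurePreserving (fun p : (ι → X) × (κ → X) => (Sum.elim p.1 p.2 : ι ⊕ κ → X))
      ((Measure.pi fun _ => μ).prod (Measure.pi fun _ => μ)) (Measure.pi fun _ => μ) := by
  have h := measurePreserving_sumPiEquivProdPi_symm (X := fun _ : ι ⊕ κ => X) (fun _ => μ)
  convert h using 1
  funext p i
  rcases i with i | i <;> rfl

/-- The term `N * ∫ z, f z ∂μ` is the mean of the sum over an independent sample `x'`, and `t ↦ exp
(a * |t|)` is convex, so this is Jensen in `x'` with `x` fixed. -/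
lemma exp_abs_sum_sub_integral_le {X : Type*} [MeasurableSpace X] {μ : Measure X}
    [IsProbabilityMeasure μ] {N : ℕ} {f : X → ℝ} (hf : ∀ x, f x ∈ Set.Icc (-1 : ℝ) 1)
    (hfm : Measurable f) (x : Fin N → X) {a : ℝ} (ha : 0 ≤ a) :
    ENNReal.ofReal (Real.exp (a * |∑ j, f (x j) - N * ∫ z, f z ∂μ|))
      ≤ ∫⁻ x' : Fin N → X, ENNReal.ofReal (Real.exp (a * |∑ j, (f (x j) - f (x' j))|))
        ∂(Measure.pi fun _ => μ) := by
  set ν : Measure (Fin N → X) := Measure.pi fun _ => μ with hν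
  set Z : (Fin N → X) → ℝ := fun x' => ∑ j, (f (x j) - f (x' j)) with hZ
  have hfj : ∀ j, Measurable fun x' : Fin N → X => f (x' j) := fun j =>
    hfm.comp (measurable_pi_apply j)
  have hZm : Measurable Z := Finset.measurable_sum _ fun j _ => measurable_const.sub (hfj j)
  have hZb : ∀ x', |Z x'| ≤ 2 * N := fun x' => by
    calc |Z x'| ≤ ∑ _j : Fin N, (2 : ℝ) := by
          refine (Finset.abs_sum_le_sum_abs _ _).trans (Finset.sum_le_sum fun j _ => ?_)
          have h1 := hf (x j)
          have h2 := hf (x' j)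
          rw [abs_le]
          constructor <;> linarith [h1.1, h1.2, h2.1, h2.2]
      _ = 2 * N := by
          rw [Finset.sum_const, Finset.card_univ, Fintype.card_fin, nsmul_eq_mul, mul_comm]
  have hZi : Integrable Z ν :=
    Integrable.of_bound hZm.aestronglyMeasurable (2 * N) (Filter.Eventually.of_forall hZb)
  have hint : ∑ j, f (x j) - N * ∫ z, f z ∂μ = ∫ x', Z x' ∂ν := by
    have hi : ∀ j, Integrable (fun x' : Fin N → X => f (x' j)) ν := fun j =>
      Integrable.of_bound (hfj j).aestronglyMeasurable 1
        (Filter.Eventually.of_forall fun x' => abs_le.2 (hf _))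
    simp only [hZ]
    rw [integral_finsetSum _ fun j _ => (integrable_const (f (x j))).sub' (hi j)]
    simp_rw [integral_sub (integrable_const _) (hi _)]
    have : ∀ j, ∫ x', f (x' j) ∂ν = ∫ z, f z ∂μ := fun j =>
      integral_comp_eval (μ := fun _ : Fin N => μ) (i := j) hfm.aestronglyMeasurable
    simp [this]
  have hEm : Measurable fun x' => Real.exp (a * |Z x'|) :=
    (hZm.abs.const_mul a).exp
  have hEi : Integrable (fun x' => Real.exp (a * |Z x'|)) ν := by
    refine Integrable.of_bound hEm.aestronglyMeasurable (Real.exp (a * (2 * N)))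
      (Filter.Eventually.of_forall fun x' => ?_)
    rw [Real.norm_eq_abs, Real.abs_exp]
    exact Real.exp_le_exp.2 (mul_le_mul_of_nonneg_left (hZb x') ha)
  rw [← ofReal_integral_eq_lintegral_ofReal hEi
    (Filter.Eventually.of_forall fun _ => (Real.exp_pos _).le), hint]
  refine ENNReal.ofReal_le_ofReal ?_
  calc Real.exp (a * |∫ x', Z x' ∂ν|) ≤ Real.exp (∫ x', a * |Z x'| ∂ν) := by
        rw [integral_const_mul]
        exact Real.exp_le_exp.2 (mul_le_mul_of_nonneg_left (abs_integral_le_integral_abs) ha)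
    _ ≤ ∫ x', Real.exp (a * |Z x'|) ∂ν :=
        convexOn_exp.map_integral_le Real.continuous_exp.continuousOn isClosed_univ
          (Filter.Eventually.of_forall fun _ => Set.mem_univ _) (hZi.abs.const_mul a) hEi

/-- A uniform deviation bound for a class of functions with values in `[-1, 1]`. -/
lemma measure_deviation_le {X : Type*} [MeasurableSpace X] {μ : Measure X}
    [IsProbabilityMeasure μ] {N : ℕ} {F : Set (X → ℝ)}
    (hF : ∀ f ∈ F, ∀ x, f x ∈ Set.Icc (-1 : ℝ) 1) (hFf : ∀ f ∈ F, Measurable f)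
    (hFm : IsMeasurableClass μ F) {R : ℝ}
    (hR : ∀ (y : Fin N ⊕ Fin N → X) t, ((patterns F y t).card : ℝ) ≤ R) {a : ℝ} (ha : 0 ≤ a)
    (c : ℝ) :
    (Measure.pi fun _ : Fin N => μ)
        {x | ∃ f ∈ F, c ≤ |∑ j, f (x j) - N * ∫ z, f z ∂μ|}
      ≤ ENNReal.ofReal (2 * Real.exp 1 * R * Real.exp (2 * a ^ 2 * N) / Real.exp (a * c)) := by
  rcases F.eq_empty_or_nonempty with rfl | hne
  · simp
  set ν : Measure (Fin N → X) := Measure.pi fun _ => μ with hν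
  set τ : Fin N ⊕ Fin N → ℝ := ghostSign fun _ => true with hτ
  set Φ : (Fin N → X) × (Fin N → X) → ENNReal := fun p =>
    ENNReal.ofReal (Real.exp (a * signedSup F τ (Sum.elim p.1 p.2))) with hΦ
  have hmp := measurePreserving_sumElim (ι := Fin N) (κ := Fin N) μ
  have hm0 : AEMeasurable (fun y => ENNReal.ofReal (Real.exp (a * signedSup F τ y)))
      (Measure.pi fun _ : Fin N ⊕ Fin N => μ) :=
    ((hFm.aemeasurable_signedSup (ghostSign_eq _)).const_mul a).exp.ennreal_ofReal
  have hΦm : AEMeasurable Φ (ν.prod ν) :=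
    hm0.comp_quasiMeasurePreserving hmp.quasiMeasurePreserving
  have hΦi : ∫⁻ x, ∫⁻ x', Φ (x, x') ∂ν ∂ν
      ≤ ENNReal.ofReal (2 * Real.exp 1 * R * Real.exp (2 * a ^ 2 * N)) := by
    rw [← lintegral_prod Φ hΦm]
    refine le_trans (le_of_eq ?_) (lintegral_exp_signedSup_le hne hF hFm hR ha)
    rw [← hmp.map_eq, lintegral_map' (by rw [hmp.map_eq]; exact hm0) hmp.measurable.aemeasurable]
  -- The deviation event need not be measurable; it is enclosed in a superlevel set of an a.e.
  -- measurable function, to which Markov's inequality applies.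
  have hsub : {x | ∃ f ∈ F, c ≤ |∑ j, f (x j) - N * ∫ z, f z ∂μ|}
      ⊆ {x | ENNReal.ofReal (Real.exp (a * c)) ≤ ∫⁻ x', Φ (x, x') ∂ν} := by
    rintro x ⟨f, hf, hc⟩
    calc ENNReal.ofReal (Real.exp (a * c))
        ≤ ENNReal.ofReal (Real.exp (a * |∑ j, f (x j) - N * ∫ z, f z ∂μ|)) :=
          ENNReal.ofReal_le_ofReal (Real.exp_le_exp.2 (mul_le_mul_of_nonneg_left hc ha))
      _ ≤ _ := exp_abs_sum_sub_integral_le (hF f hf) (hFf f hf) x ha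
      _ ≤ ∫⁻ x', Φ (x, x') ∂ν := by
          refine lintegral_mono fun x' => ENNReal.ofReal_le_ofReal (Real.exp_le_exp.2
            (mul_le_mul_of_nonneg_left ?_ ha))
          refine le_trans (le_of_eq ?_) (abs_signed_le_signedSup hF (Sum.elim x x') hf)
          rw [hτ, sum_ghostSign_mul _ fun i => f (Sum.elim x x' i)]
          simp [boolSign]
  refine (measure_mono hsub).trans ?_
  have hmarkov := mul_meas_ge_le_lintegral₀ hΦm.lintegral_prod_right'
    (ENNReal.ofReal (Real.exp (a * c)))
  rw [ENNReal.ofReal_div_of_pos (Real.exp_pos _), ENNReal.le_div_iff_mul_le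
    (Or.inl (by simp [Real.exp_pos])) (Or.inl ENNReal.ofReal_ne_top), mul_comm]
  exact hmarkov.trans hΦi

/-! ### Generalization from the sample to the distribution -/

/-- Sauer–Shelah with `M = max (2 * N) d` gives the base `2 * exp 1 * m` at most; since `2 ≤ exp 1`
and `1 ≤ m`, this is at most `(exp 1 * m) ^ 2`, whence the factor `2` in the exponent. -/
lemma card_patterns_ghost_le {X : Type*} {F : Set (X → ℝ)} {d N : ℕ} (hd : pdim F = d)
    (y : Fin N ⊕ Fin N → X) (t : Fin N ⊕ Fin N → ℝ) :
    ((patterns F y t).card : ℝ)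
      ≤ Real.exp (2 * (d * Real.log (Real.exp 1 * max 1 ((N : ℝ) / d)))) := by
  set m : ℝ := max 1 ((N : ℝ) / d) with hm
  have hm1 : 1 ≤ m := le_max_left _ _
  have h1 : ((patterns F y t).card : ℝ) ≤ _ := Nat.cast_le.2 (card_patterns_le hd y t)
  refine h1.trans ((sum_choose_le_pow (M := max (2 * N : ℝ) d) (by simp [two_mul])
    (le_max_right _ _)).trans ?_)
  rcases Nat.eq_zero_or_pos d with rfl | hd0
  · simp
  have hd0' : (0 : ℝ) < d := by exact_mod_cast hd0
  have he : (2 : ℝ) ≤ Real.exp 1 := by linarith [Real.add_one_le_exp 1]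
  have hMd : max (2 * N : ℝ) d ≤ 2 * m * d := by
    refine max_le ?_ ?_
    · have : (N : ℝ) / d ≤ m := le_max_right _ _
      rw [div_le_iff₀ hd0'] at this
      linarith
    · nlinarith
  have h2 : Real.exp 1 * max (2 * N : ℝ) d / d ≤ (Real.exp 1 * m) ^ 2 := by
    rw [div_le_iff₀ hd0']
    calc Real.exp 1 * max (2 * N : ℝ) d ≤ Real.exp 1 * (2 * m * d) := by gcongr
      _ ≤ Real.exp 1 * (Real.exp 1 * (m * m) * d) := by
          gcongr ?_ * (?_ * _)
          nlinarith
      _ = _ := by ring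
  have h3 : Real.exp (2 * (d * Real.log (Real.exp 1 * m))) = ((Real.exp 1 * m) ^ 2) ^ d := by
    rw [show 2 * (d * Real.log (Real.exp 1 * m)) = ((2 * d : ℕ) : ℝ) * Real.log (Real.exp 1 * m) by
      push_cast; ring, Real.exp_nat_mul, Real.exp_log (by positivity), pow_mul]
  rw [h3]
  gcongr

/-- The exponential bound is applied with `a = √((L + l) / N)`, which makes `a ^ 2 * N = L + l` and
is at most the error rate because the square root is subadditive. -/
lemma measure_deviation_errorRate_le {X : Type*} [MeasurableSpace X] {μ : Measure X}
    [IsProbabilityMeasure μ] {n N d : ℕ} (hn : 0 < n) (hN : 0 < N) {δ : ℝ} (hδ : 0 < δ)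
    (hδ1 : δ < 1) {F : Set (X → ℝ)} (hF : ∀ f ∈ F, ∀ x, f x ∈ Set.Icc (-1 : ℝ) 1)
    (hFf : ∀ f ∈ F, Measurable f) (hFm : IsMeasurableClass μ F) (hd : pdim F = d) :
    (Measure.pi fun _ : Fin N => μ)
        {x | ∃ f ∈ F, 7 * errorRate n N d δ * N ≤ |∑ j, f (x j) - N * ∫ z, f z ∂μ|}
      ≤ ENNReal.ofReal (δ / n) := by
  have hn' : (1 : ℝ) ≤ n := by exact_mod_cast hn
  have hN' : (0 : ℝ) < N := by exact_mod_cast hN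
  set L : ℝ := d * Real.log (Real.exp 1 * max 1 ((N : ℝ) / d)) with hL
  set l : ℝ := Real.log (2 * n / δ) with hl
  have hL0 : 0 ≤ L := by
    refine mul_nonneg (Nat.cast_nonneg _) (Real.log_nonneg ?_)
    have h1 : 1 ≤ max 1 ((N : ℝ) / d) := le_max_left _ _
    have h2 : 1 ≤ Real.exp 1 := by linarith [Real.add_one_le_exp 1]
    nlinarith
  have hl2 : Real.log 2 ≤ l := by
    refine Real.log_le_log two_pos ?_
    rw [le_div_iff₀ hδ]
    nlinarith
  have hlog2 : 1 / 2 ≤ Real.log 2 := by linarith [Real.log_two_gt_d9]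
  set A : ℝ := L + l with hA
  have hA0 : 0 < A := by linarith
  set r : ℝ := Real.sqrt (A / N) with hr
  have hr2 : r * r = A / N := Real.mul_self_sqrt (by positivity)
  have hrate : r ≤ errorRate n N d δ := by
    rw [hr, hA, add_div, errorRate, div_mul_eq_mul_div]
    have hl0 : 0 ≤ l := by linarith
    have h1 : 0 ≤ L / N := by positivity
    have h2 : 0 ≤ l / N := by positivity
    rw [Real.sqrt_le_left (by positivity), add_sq, Real.sq_sqrt h1, Real.sq_sqrt h2]
    have : 0 ≤ 2 * Real.sqrt (L / N) * Real.sqrt (l / N) := by positivity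
    linarith
  refine (measure_deviation_le hF hFf hFm (fun y t => card_patterns_ghost_le hd y t)
    (Real.sqrt_nonneg (A / N)) (7 * errorRate n N d δ * N)).trans (ENNReal.ofReal_le_ofReal ?_)
  rw [← hL, ← hr]
  have hδn : δ / n = Real.exp (Real.log 2 - l) := by
    rw [hl, ← Real.log_div two_ne_zero (by positivity), Real.exp_log (by positivity)]
    field_simp
  have h2 : (2 : ℝ) = Real.exp (Real.log 2) := (Real.exp_log two_pos).symm
  have hexp : 2 * Real.exp 1 * Real.exp (2 * L) * Real.exp (2 * r ^ 2 * N)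
      = Real.exp (Real.log 2 + 1 + 2 * L + 2 * r ^ 2 * N) := by
    rw [Real.exp_add, Real.exp_add, Real.exp_add, ← h2]
  rw [hexp, ← Real.exp_sub, hδn]
  apply Real.exp_le_exp.2
  have h3 : r ^ 2 * N = A := by
    rw [sq, hr2]; field_simp
  have h4 : 7 * A ≤ r * (7 * errorRate n N d δ * N) := by
    calc 7 * A = r * (7 * r * N) := by rw [← h3]; ring
      _ ≤ _ := by gcongr
  -- With `A = L + l` it remains that `1 + 2 * L + 2 * A + l ≤ 7 * A`, which follows from `l ≥ log 2
  -- ≥ 1 / 2`.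
  nlinarith

lemma empiricalGain_eq_sum_gainVector {n N : ℕ} {Θ : Fin n → Type*} {O : Type*}
    (util : Fin n → Profile Θ → O → ℝ) (i : Fin n) (M : Mechanism Θ O)
    (x : Fin N → Others Θ i) (p : Θ i × Θ i) :
    empiricalGain util i M x p = ∑ j, gainVector util i M x p j := by
  simp only [empiricalGain, gainVector, Finset.mul_sum]

/-- The returned pairs cover the gain vectors of all pairs up to `ε`. -/
lemma GreedyReturns.exists_empiricalGain_le {n N : ℕ} {Θ : Fin n → Type*} {O : Type*}
    {util : Fin n → Profile Θ → O → ℝ} {ε : ℝ} {B : (Fin N → ℝ) → ℝ → Set (Fin N → ℝ)}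
    (hB : B = openBall ∨ B = closedBall) {i : Fin n} {M : Mechanism Θ O}
    {x : Fin N → Others Θ i} {G : Finset (Θ i × Θ i)}
    (hG : GreedyReturns B (gainVector util i M x) ε G) (p : Θ i × Θ i) :
    ∃ q ∈ G, empiricalGain util i M x p ≤ empiricalGain util i M x q + ε := by
  obtain ⟨V, hV, hempty⟩ := hG
  have hcov : gainVector util i M x p ∈ ⋃ v ∈ V, B v ε := by
    by_contra hnot
    have : gainVector util i M x p ∈ uncovered B (gainVector util i M x) ε V := ⟨⟨p, rfl⟩, hnot⟩
    rw [hempty] at this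
    exact this
  obtain ⟨v, hv, hpv⟩ := Set.mem_iUnion₂.1 hcov
  obtain ⟨q, hq, rfl⟩ := (greedy_invariant hB hV).2.1 v hv
  have hdist : ∑ j, |gainVector util i M x p j - gainVector util i M x q j| ≤ ε := by
    rcases hB with rfl | rfl
    · exact le_of_lt hpv
    · exact hpv
  refine ⟨q, hq, ?_⟩
  rw [empiricalGain_eq_sum_gainVector, empiricalGain_eq_sum_gainVector]
  have h1 := (Finset.abs_sum_le_sum_abs (fun j => gainVector util i M x p j
    - gainVector util i M x q j) Finset.univ).trans hdist
  rw [Finset.sum_sub_distrib] at h1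
  linarith [(abs_le.1 h1).2]

instance {n : ℕ} {Θ : Fin n → Type*} [∀ j, MeasurableSpace (Θ j)] (D : ∀ j, Measure (Θ j))
    [∀ j, IsProbabilityMeasure (D j)] (i : Fin n) : IsProbabilityMeasure (othersLaw D i) := by
  unfold othersLaw
  infer_instance

/-- If all utilities deviate on average over the sample by less than `c` from their means, then
the true gain exceeds the empirical gain by at most `2 c`. -/
lemma trueGain_le_empiricalGain_add {n N : ℕ} {Θ : Fin n → Type*} {O : Type*}
    [∀ j, MeasurableSpace (Θ j)] {D : ∀ j, Measure (Θ j)} [∀ j, IsProbabilityMeasure (D j)]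
    {util : Fin n → Profile Θ → O → ℝ} {Ms : Set (Mechanism Θ O)} (hN : 0 < N) {i : Fin n}
    {M : Mechanism Θ O} (hM : M ∈ Ms)
    (hu : ∀ θ θ', utility util i M θ θ' ∈ Set.Icc (-1 : ℝ) 1)
    (hm : ∀ f ∈ utilityClass util Ms i, Measurable f) {x : Fin N → Others Θ i} {c : ℝ}
    (hx : ∀ f ∈ utilityClass util Ms i, |∑ j, f (x j) - N * ∫ z, f z ∂(othersLaw D i)| < c * N)
    (t t' : Θ i) : trueGain util D i M t t' ≤ empiricalGain util i M x (t, t') + 2 * c := by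
  have hN' : (0 : ℝ) < N := by exact_mod_cast hN
  have hmem : ∀ s s', utilityTruthfulOthers util i M s s' ∈ utilityClass util Ms i :=
    fun s s' => ⟨M, hM, s, s', rfl⟩
  have hint : ∀ s s', Integrable (utilityTruthfulOthers util i M s s') (othersLaw D i) :=
    fun s s' => Integrable.of_bound (hm _ (hmem s s')).aestronglyMeasurable 1
      (Filter.Eventually.of_forall fun _ => abs_le.2 (hu _ _))
  have h1 := abs_lt.1 (hx _ (hmem t t'))
  have h2 := abs_lt.1 (hx _ (hmem t t))
  rw [trueGain, integral_sub (hint _ _) (hint _ _), empiricalGain, Finset.sum_sub_distrib,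
    ← mul_le_mul_iff_right₀ hN']
  have h3 : ∀ S : ℝ, N * (1 / (N : ℝ) * S + 2 * c) = S + 2 * (c * N) := fun S => by
    field_simp
  rw [h3]
  nlinarith [h1.1, h2.2]

end AIC

/-! ### The theorem: union bound over the agents -/

theorem mainTheorem2 :
    ∃ C : ℝ, 0 < C ∧
      ∀ (n N : ℕ) (Θ : Fin n → Type*) (O : Type*)
        (util : Fin n → AIC.Profile Θ → O → ℝ) (Ms : Set (AIC.Mechanism Θ O))
        (d : Fin n → ℕ) (ε : ℝ)
        (B : (Fin N → ℝ) → ℝ → Set (Fin N → ℝ)),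
        0 < N → 0 < ε →
        (∀ i, ∀ M ∈ Ms, ∀ θ θ', AIC.utility util i M θ θ' ∈ Set.Icc (-1 : ℝ) 1) →
        (∀ i, AIC.pdim (AIC.utilityClass util Ms i) = d i) →
        (B = AIC.openBall ∨ B = AIC.closedBall) →
        -- the guarantee that holds with probability at least `1 - δ`
        (∀ [∀ j, MeasurableSpace (Θ j)] (D : ∀ j, Measure (Θ j))
          [∀ j, IsProbabilityMeasure (D j)] (δ : ℝ)
          (Ω : Type*) [MeasurableSpace Ω] (Pr : Measure Ω) [IsProbabilityMeasure Pr]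
          (S : ∀ i, Ω → Fin N → AIC.Others Θ i),
          0 < δ → δ < 1 →
          (∀ i, ∀ f ∈ AIC.utilityClass util Ms i, Measurable f) →
          (∀ i, AIC.IsMeasurableClass (AIC.othersLaw D i) (AIC.utilityClass util Ms i)) →
          (∀ i, Measurable (S i)) →
          (∀ i, Pr.map (S i) = Measure.pi fun _ : Fin N => AIC.othersLaw D i) →
          Pr {ω | ¬ ∀ M ∈ Ms, ∀ i, ∀ G : Finset (Θ i × Θ i),
              AIC.GreedyReturns B (AIC.gainVector util i M (S i ω)) ε G →
              ∀ t t' : Θ i, ∃ hG : G.Nonempty,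
                AIC.trueGain util D i M t t'
                  ≤ G.sup' hG (AIC.empiricalGain util i M (S i ω)) + ε
                    + C * AIC.errorRate n N (d i) δ}
            ≤ ENNReal.ofReal δ) ∧
        -- the bound on the size of the cover, for every sample
        (∀ M ∈ Ms, ∀ i, ∀ x : Fin N → AIC.Others Θ i,
          AIC.GreedyTerminates B (AIC.gainVector util i M x) ε ∧
          (ε * d i ≤ 8 * N →
            ∀ G : Finset (Θ i × Θ i),
              AIC.GreedyReturns B (AIC.gainVector util i M x) ε G →
              (G.card : ℝ) ≤ (8 * Real.exp 1 * N / (ε * d i)) ^ (2 * d i))) := by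
  -- A gain involves two utilities, each of which deviates by less than `7` times the error rate.
  refine ⟨14, by norm_num, ?_⟩
  intro n N Θ O util Ms d ε B hN hε hu hd hB
  refine ⟨?_, fun M hM i x => ⟨AIC.greedyTerminates hB hN hε hM (hu i M hM) x,
    fun hεd G hG => AIC.greedyReturns_card_le hB hN hε hM (hu i M hM) x (hd i) hεd hG⟩⟩
  intro _ D _ δ Ω _ Pr _ S hδ hδ1 hm hclass hS hlaw
  -- This event involves neither the mechanism nor the output, so its complement serves all of them
  -- at once.
  set bad : ∀ i, Set (Fin N → AIC.Others Θ i) := fun i =>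
    {x | ∃ f ∈ AIC.utilityClass util Ms i, 7 * AIC.errorRate n N (d i) δ * N
      ≤ |∑ j, f (x j) - N * ∫ z, f z ∂(AIC.othersLaw D i)|} with hbad
  have hF : ∀ i, ∀ f ∈ AIC.utilityClass util Ms i, ∀ x, f x ∈ Set.Icc (-1 : ℝ) 1 := by
    rintro i _ ⟨M, hM, t, t', rfl⟩ x
    exact hu i M hM _ _
  have hprob : ∀ i, Pr (S i ⁻¹' bad i) ≤ ENNReal.ofReal (δ / n) := fun i => by
    -- This inequality holds for outer measure, so `bad i` need not be measurable.
    refine (Measure.le_map_apply (hS i).aemeasurable _).trans ?_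
    rw [hlaw i]
    exact AIC.measure_deviation_errorRate_le i.pos hN hδ hδ1 (hF i) (hm i) (hclass i) (hd i)
  have hsub : {ω | ¬ ∀ M ∈ Ms, ∀ i, ∀ G : Finset (Θ i × Θ i),
      AIC.GreedyReturns B (AIC.gainVector util i M (S i ω)) ε G →
      ∀ t t' : Θ i, ∃ hG : G.Nonempty,
        AIC.trueGain util D i M t t'
          ≤ G.sup' hG (AIC.empiricalGain util i M (S i ω)) + ε
            + 14 * AIC.errorRate n N (d i) δ} ⊆ ⋃ i, S i ⁻¹' bad i := by
    intro ω hω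
    by_contra hgood
    refine hω fun M hM i G hG t t' => ?_
    obtain ⟨q, hq, hle⟩ := hG.exists_empiricalGain_le hB (t, t')
    have hx : ∀ f ∈ AIC.utilityClass util Ms i,
        |∑ j, f (S i ω j) - N * ∫ z, f z ∂(AIC.othersLaw D i)|
          < 7 * AIC.errorRate n N (d i) δ * N := by
      intro f hf
      by_contra! hc
      exact hgood (Set.mem_iUnion.2 ⟨i, f, hf, hc⟩)
    refine ⟨⟨q, hq⟩, ?_⟩
    have h1 := AIC.trueGain_le_empiricalGain_add hN hM (hu i M hM) (hm i) hx t t'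
    have h2 := Finset.le_sup' (AIC.empiricalGain util i M (S i ω)) hq
    linarith
  -- The union bound asks nothing of the joint law of the samples of different agents.
  calc _ ≤ Pr (⋃ i, S i ⁻¹' bad i) := measure_mono hsub
    _ ≤ ∑ i, Pr (S i ⁻¹' bad i) := measure_iUnion_fintype_le _ _
    _ ≤ ∑ _i : Fin n, ENNReal.ofReal (δ / n) := Finset.sum_le_sum fun i _ => hprob i
    _ ≤ ENNReal.ofReal δ := by
      rw [← ENNReal.ofReal_sum_of_nonneg fun _ _ => by positivity]
      refine ENNReal.ofReal_le_ofReal ?_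
      rw [Finset.sum_const, Finset.card_univ, Fintype.card_fin, nsmul_eq_mul]
      rcases Nat.eq_zero_or_pos n with rfl | hn
      · simpa using hδ.le
      · have : (n : ℝ) ≠ 0 := by exact_mod_cast hn.ne'
        exact (mul_div_cancel₀ _ this).le
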